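/- A sequence $(s_k)_{k\in\mathbb N_0}$ of real numbers is called positive if $\sum_{i,j=0}^n x_ix_js_{i+j}\ge 0$ for all $n\in\mathbb N_0$ and $x_0,\dots,x_n\in\mathbb R$, and positive definite if the Hankel matrix $H_n=[s_{i+j}]_{i,j=0}^n$ is positive definite for every $n\in\mathbb N_0$. For a set $P\subseteq\mathbb N_0$, a partial sequence with pattern $P$ is a family $(s_k)_{k\in P}$ of real numbers. It is partial positive definite (respectively partial positive semidefinite) if, for every $n$, every fully specified principal submatrix of $H_n=[s_{i+j}]_{i,j=0}^n$ is positive definite (respectively positive semidefinite); here the principal submatrix with index set $\alpha\subseteq\{0,\dots,n\}$ is fully specified if $i+j\in P$ for all $i,j\in\alpha$. The pattern $P$ is positive definite completable if every partial positive definite sequence $(s_k)_{k\in P}$ extends to a positive definite sequence $(s_k)_{k\in\mathbb N_0}$. It is positive semidefinite completable if every partial positive semidefinite sequence $(s_k)_{k\in P}$ extends to a positive sequence $(s_k)_{k\in\mathbb N_0}$. Theorem. Let $m\ge 0$ and $d\ge 1$ be integers, let $l_0\ge 0$ be an even integer, and let $P=\{0,1,\dots,m\}$. 1. If $m\ge 1$,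 then the pattern $dP+l_0=\{dk+l_0 : k\in P\}$ is not positive semidefinite completable. 2. The pattern $dP=\{dk : k\in P\}$ is positive definite completable. -/

import Mathlib

namespace HankelCompletion

/-- The Hankel matrix `H_n = [s_{i+j}]`, `0 ≤ i, j ≤ n`, of a real sequence. -/
def hankel (s : ℕ → ℝ) (n : ℕ) : Matrix (Fin (n + 1)) (Fin (n + 1)) ℝ :=
  Matrix.of fun i j => s ((i : ℕ) + (j : ℕ))

/-- A real sequence is positive if all its Hankel quadratic forms are nonnegative. -/
def IsPositive (s : ℕ → ℝ) : Prop :=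
  ∀ (n : ℕ) (x : Fin (n + 1) → ℝ), 0 ≤ ∑ i, ∑ j, x i * x j * s ((i : ℕ) + (j : ℕ))

/-- A real sequence is positive definite if all its Hankel matrices are positive definite. -/
def IsPositiveDefinite (s : ℕ → ℝ) : Prop :=
  ∀ n : ℕ, (hankel s n).PosDef

/-- A partial sequence with pattern `P`: the terms with index in `P` are specified,
the others are missing. -/
abbrev PartialSeq (P : Set ℕ) : Type := P → ℝ

/-- The principal submatrix `H_n[α]` of the partial Hankel matrix `H_n` is fully specified. -/
def FullySpecified (P : Set ℕ) {n : ℕ} (α : Finset (Fin (n + 1))) : Prop :=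
  ∀ i ∈ α, ∀ j ∈ α, (i : ℕ) + (j : ℕ) ∈ P

/-- A fully specified principal submatrix `H_n[α]` of the partial Hankel matrix `H_n`. -/
def principalSubmatrix {P : Set ℕ} (s : PartialSeq P) {n : ℕ} (α : Finset (Fin (n + 1)))
    (h : FullySpecified P α) : Matrix α α ℝ :=
  Matrix.of fun i j => s ⟨((i : Fin (n + 1)) : ℕ) + ((j : Fin (n + 1)) : ℕ), h i i.2 j j.2⟩

/-- Every fully specified principal submatrix of every `H_n` is positive definite. -/
def IsPartialPositiveDefinite {P : Set ℕ} (s : PartialSeq P) : Prop :=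
  ∀ (n : ℕ) (α : Finset (Fin (n + 1))) (h : FullySpecified P α), (principalSubmatrix s α h).PosDef

/-- Every fully specified principal submatrix of every `H_n` is positive semidefinite. -/
def IsPartialPositiveSemidefinite {P : Set ℕ} (s : PartialSeq P) : Prop :=
  ∀ (n : ℕ) (α : Finset (Fin (n + 1))) (h : FullySpecified P α),
    (principalSubmatrix s α h).PosSemidef

/-- The full sequence `t` has the specified terms of `s`. -/
def IsCompletion {P : Set ℕ} (s : PartialSeq P) (t : ℕ → ℝ) : Prop :=
  ∀ k : P, t k = s k

/-- Every partial positive definite sequence with pattern `P` has a positive definite completion. -/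
def PositiveDefiniteCompletable (P : Set ℕ) : Prop :=
  ∀ s : PartialSeq P, IsPartialPositiveDefinite s →
    ∃ t : ℕ → ℝ, IsCompletion s t ∧ IsPositiveDefinite t

/-- Every partial positive semidefinite sequence with pattern `P` has a positive completion. -/
def PositiveSemidefiniteCompletable (P : Set ℕ) : Prop :=
  ∀ s : PartialSeq P, IsPartialPositiveSemidefinite s →
    ∃ t : ℕ → ℝ, IsCompletion s t ∧ IsPositive t

/-- The pattern `dP + l = {d k + l | k ∈ P}`. -/
def affinePattern (d l : ℕ) (P : Set ℕ) : Set ℕ :=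
  (fun k => d * k + l) '' P

end HankelCompletion

/-! Part 1: let the last specified term be 1 and all others 0. Every fully specified principal
submatrix is then diagonal with entries 0 or 1, but a positive completion with a zero diagonal entry
has a zero row there, which contains the last term.

Part 2: complete by moments of a measure. Fully specified blocks give a positive definite Hankel
matrix of a rescaled sequence. Subtracting ε times the moments `1/(k+1)` of Lebesgue measure on
[0,1], taken at the original indices, keeps it positive definite for small ε. Gaussian quadrature
(`exists_quadrature`) represents what is left by finitely many atoms, real roots of the atoms undo
the rescaling, and adding back the Lebesgue part makes every Hankel matrix positive definite. -/

open Matrix in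
/-- The moments `⟨x, Aᵏ x⟩` of a real symmetric matrix are moments of an atomic measure. -/
theorem Matrix.IsHermitian.exists_dotProduct_pow_mulVec_eq_sum {n : Type*} [Fintype n]
    [DecidableEq n] {A : Matrix n n ℝ} (hA : A.IsHermitian) (x : n → ℝ) :
    ∃ w : n → ℝ, (∀ i, 0 ≤ w i) ∧
      ∀ k : ℕ, x ⬝ᵥ (A ^ k *ᵥ x) = ∑ i, w i * hA.eigenvalues i ^ k := by
  set U : Matrix n n ℝ := (hA.eigenvectorUnitary : Matrix n n ℝ)
  refine ⟨fun i => (star U *ᵥ x) i ^ 2, fun i => sq_nonneg _, fun k => ?_⟩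
  have hpow : A ^ k = U * diagonal (fun i => hA.eigenvalues i ^ k) * star U := by
    conv_lhs => rw [hA.spectral_theorem]
    rw [← map_pow, diagonal_pow, Unitary.conjStarAlgAut_apply]
    rfl
  have hx : x ᵥ* U = star U *ᵥ x := by
    rw [star_eq_conjTranspose, conjTranspose_eq_transpose_of_trivial, mulVec_transpose]
  rw [hpow, ← mulVec_mulVec, ← mulVec_mulVec, dotProduct_mulVec, hx]
  simp only [dotProduct, mulVec_diagonal]
  exact Finset.sum_congr rfl fun i _ => by ring

open Matrix MatrixOrder in
theorem Matrix.PosDef.exists_isUnit_eq_conjTranspose_mul_self {n : Type*} [Fintype n]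
    [DecidableEq n] {A : Matrix n n ℝ} (hA : A.PosDef) :
    ∃ B : Matrix n n ℝ, IsUnit B ∧ A = Bᴴ * B := by
  exact CStarAlgebra.isStrictlyPositive_iff_eq_star_mul_self.mp hA.isStrictlyPositive

open Matrix in
/-- A small symmetric perturbation of a positive definite matrix is positive definite. -/
theorem Matrix.PosDef.exists_pos_posDef_sub_smul {n : Type*} [Fintype n] [DecidableEq n]
    {A G : Matrix n n ℝ} (hA : A.PosDef) (hG : G.IsHermitian) :
    ∃ ε : ℝ, 0 < ε ∧ (A - ε • G).PosDef := by
  obtain ⟨B, hB, rfl⟩ := hA.exists_isUnit_eq_conjTranspose_mul_self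
  obtain ⟨C, hBC, hCB⟩ := isUnit_iff_exists.1 hB
  have hK : (Cᴴ * G * C).IsHermitian := isHermitian_conjTranspose_mul_mul C hG
  -- The congruence by `C`, the inverse of `B`, turns `A` into the identity, so it is enough that ε
  -- times each eigenvalue of `Cᴴ * G * C` is below 1. The sum `r` bounds them all, also when the
  -- index type is empty.
  set r := ∑ i, |hK.eigenvalues i|
  have hr0 : 0 ≤ r := Finset.sum_nonneg fun i _ => abs_nonneg _
  refine ⟨(r + 1)⁻¹, by positivity, ?_⟩
  have hfac : Bᴴ * B - (r + 1)⁻¹ • G = star B * (1 - (r + 1)⁻¹ • (Cᴴ * G * C)) * B := by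
    have h1 : Bᴴ * Cᴴ = 1 := by rw [← conjTranspose_mul, hCB, conjTranspose_one]
    have h2 : Bᴴ * (Cᴴ * G * C) * B = G := by
      calc Bᴴ * (Cᴴ * G * C) * B = (Bᴴ * Cᴴ) * G * (C * B) := by simp only [Matrix.mul_assoc]
        _ = G := by rw [h1, hCB, Matrix.one_mul, Matrix.mul_one]
    rw [star_eq_conjTranspose, Matrix.mul_sub, Matrix.sub_mul, Matrix.mul_one, mul_smul_comm,
      smul_mul_assoc, h2]
  rw [hfac, hB.posDef_star_left_conjugate_iff]
  set U := hK.eigenvectorUnitary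
  have hdiag : 1 - (r + 1)⁻¹ • (Cᴴ * G * C) =
      (U : Matrix n n ℝ) * diagonal (fun i => 1 - (r + 1)⁻¹ * hK.eigenvalues i) *
        star (U : Matrix n n ℝ) := by
    conv_lhs => rw [hK.spectral_theorem]
    rw [← Unitary.conjStarAlgAut_apply (S := ℝ), ← map_one (Unitary.conjStarAlgAut ℝ _ U),
      ← map_smul, ← map_sub]
    congr 1
    ext i j
    by_cases h : i = j <;> simp [h, diagonal]
  have hU : IsUnit (U : Matrix n n ℝ) := (Unitary.toUnits U).isUnit
  rw [hdiag, hU.posDef_star_right_conjugate_iff, posDef_diagonal_iff]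
  intro i
  have h1 : hK.eigenvalues i ≤ r :=
    (le_abs_self _).trans (Finset.single_le_sum (f := fun i => |hK.eigenvalues i|)
      (fun i _ => abs_nonneg _) (Finset.mem_univ i))
  rw [sub_pos, inv_mul_lt_iff₀ (by positivity)]
  linarith

open Matrix in
/-- A matrix that decouples along a predicate is positive definite if both blocks are. -/
theorem Matrix.PosDef.of_submatrix_subtype {n : Type*} [Fintype n] [DecidableEq n]
    {A : Matrix n n ℝ} (p : n → Prop) [DecidablePred p] (hA : A.IsHermitian)
    (h0 : ∀ i j, p i → ¬ p j → A i j = 0)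
    (h1 : (A.submatrix ((↑) : {i // p i} → n) (↑)).PosDef)
    (h2 : (A.submatrix ((↑) : {i // ¬ p i} → n) (↑)).PosDef) : A.PosDef := by
  refine .of_dotProduct_mulVec_pos hA fun x hx => ?_
  have h0' : ∀ i j, ¬ p i → p j → A i j = 0 := fun i j hi hj => by
    rw [← hA.apply, h0 j i hj hi, star_zero]
  have key : star x ⬝ᵥ (A *ᵥ x) =
      star (fun i : {i // p i} => x i) ⬝ᵥ
        ((A.submatrix ((↑) : {i // p i} → n) (↑)) *ᵥ fun i : {i // p i} => x i) +
      star (fun i : {i // ¬ p i} => x i) ⬝ᵥ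
        ((A.submatrix ((↑) : {i // ¬ p i} → n) (↑)) *ᵥ fun i : {i // ¬ p i} => x i) := by
    simp only [dotProduct, mulVec, submatrix_apply, Pi.star_apply, star_trivial]
    rw [← Fintype.sum_subtype_add_sum_subtype p]
    congr 1
    · refine Finset.sum_congr rfl fun i _ => ?_
      rw [← Fintype.sum_subtype_add_sum_subtype p, add_eq_left.2]
      exact Finset.sum_eq_zero fun j _ => by rw [h0 i j i.2 j.2, zero_mul]
    · refine Finset.sum_congr rfl fun i _ => ?_
      rw [← Fintype.sum_subtype_add_sum_subtype p, add_eq_right.2]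
      exact Finset.sum_eq_zero fun j _ => by rw [h0' i j i.2 j.2, zero_mul]
  rw [key]
  obtain ⟨i, hi⟩ := Function.ne_iff.1 hx
  by_cases hp : p i
  · exact add_pos_of_pos_of_nonneg
      (h1.dotProduct_mulVec_pos fun h => hi (congrFun h ⟨i, hp⟩))
      (h2.posSemidef.dotProduct_mulVec_nonneg _)
  · exact add_pos_of_nonneg_of_pos (h1.posSemidef.dotProduct_mulVec_nonneg _)
      (h2.dotProduct_mulVec_pos fun h => hi (congrFun h ⟨i, hp⟩))

/-! ### Hankel matrices, quadrature and atomic measures -/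

namespace HankelCompletion

open Matrix

theorem isHermitian_hankel (s : ℕ → ℝ) (n : ℕ) : (hankel s n).IsHermitian :=
  Matrix.ext fun i j => by simp [hankel, add_comm]

theorem star_dotProduct_hankel_mulVec (s : ℕ → ℝ) (n : ℕ) (x : Fin (n + 1) → ℝ) :
    star x ⬝ᵥ (hankel s n *ᵥ x) = ∑ i, ∑ j, x i * x j * s ((i : ℕ) + (j : ℕ)) := by
  simp only [dotProduct, mulVec, hankel, of_apply, Pi.star_apply, star_trivial, Finset.mul_sum]
  exact Finset.sum_congr rfl fun i _ => Finset.sum_congr rfl fun j _ => by ring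

/-- Gaussian quadrature: a sequence whose Hankel matrix of order `n` is positive definite has, up
to degree `2n + 1`, the moments of a finitely atomic measure. -/
theorem exists_quadrature {v : ℕ → ℝ} {n : ℕ} (hv : (hankel v n).PosDef) :
    ∃ w y : Fin (n + 1) → ℝ, (∀ i, 0 ≤ w i) ∧
      ∀ k ≤ 2 * n + 1, v k = ∑ i, w i * y i ^ k := by
  obtain ⟨B, hB, hBB⟩ := hv.exists_isUnit_eq_conjTranspose_mul_self
  obtain ⟨C, hBC, hCB⟩ := isUnit_iff_exists.1 hB
  -- The shifted Hankel matrix is the form of multiplication by the variable. In the orthonormal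
  -- coordinates given by `B` it becomes the symmetric matrix `A`, whose eigenvalues are the nodes.
  set H' := hankel (fun k => v (k + 1)) n with hH'
  have hA : (Cᴴ * H' * C).IsHermitian := isHermitian_conjTranspose_mul_mul C (isHermitian_hankel _ n)
  set A := Cᴴ * H' * C with hAdef
  have hCB' : Bᴴ * Cᴴ = 1 := by rw [← conjTranspose_mul, hCB, conjTranspose_one]
  have hBC' : Cᴴ * Bᴴ = 1 := by rw [← conjTranspose_mul, hBC, conjTranspose_one]
  have hBAB : Bᴴ * (A * B) = H' := by
    calc Bᴴ * (A * B) = (Bᴴ * Cᴴ) * H' * (C * B) := by simp only [hAdef, Matrix.mul_assoc]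
      _ = H' := by rw [hCB', hCB, Matrix.one_mul, Matrix.mul_one]
  have hAB : A * B = Cᴴ * H' := by rw [hAdef, Matrix.mul_assoc, hCB, Matrix.mul_one]
  have hstep : ∀ i : ℕ, ∀ hi : i + 1 < n + 1,
      A *ᵥ B.col ⟨i, by omega⟩ = B.col ⟨i + 1, hi⟩ := by
    intro i hi
    have h1 : H'.col ⟨i, by omega⟩ = (hankel v n).col ⟨i + 1, hi⟩ := by
      ext j
      simp [hH', hankel, Matrix.col, add_assoc]
    calc A *ᵥ B.col ⟨i, by omega⟩ = (A * B).col ⟨i, by omega⟩ := by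
          ext j; simp [mulVec, dotProduct, mul_apply, Matrix.col]
      _ = Cᴴ *ᵥ H'.col ⟨i, by omega⟩ := by
          rw [hAB]; ext j; simp [mulVec, dotProduct, mul_apply, Matrix.col]
      _ = (Cᴴ * (hankel v n)).col ⟨i + 1, hi⟩ := by
          rw [h1]; ext j; simp [mulVec, dotProduct, mul_apply, Matrix.col]
      _ = B.col ⟨i + 1, hi⟩ := by rw [hBB, ← Matrix.mul_assoc, hBC', Matrix.one_mul]
  set x := B.col 0 with hx
  have hpow : ∀ i : ℕ, ∀ hi : i < n + 1, A ^ i *ᵥ x = B.col ⟨i, hi⟩ := by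
    intro i
    induction i with
    | zero => intro hi; simp [hx]
    | succ i ih =>
      intro hi
      rw [pow_succ', ← mulVec_mulVec, ih (by omega), hstep i hi]
  have hsymm : ∀ (i : ℕ) (a b : Fin (n + 1) → ℝ), (A ^ i *ᵥ a) ⬝ᵥ b = a ⬝ᵥ (A ^ i *ᵥ b) := by
    intro i a b
    have h : (A ^ i)ᵀ = A ^ i := by
      rw [← conjTranspose_eq_transpose_of_trivial]; exact hA.pow i
    rw [dotProduct_mulVec, ← mulVec_transpose, h]
  obtain ⟨w, hw, hsum⟩ := hA.exists_dotProduct_pow_mulVec_eq_sum x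
  refine ⟨w, hA.eigenvalues, hw, fun k hk => ?_⟩
  rw [← hsum]
  by_cases hk' : k ≤ 2 * n
  · obtain ⟨i, j, hi, hj, rfl⟩ : ∃ i j, i < n + 1 ∧ j < n + 1 ∧ k = i + j :=
      ⟨k / 2, k - k / 2, by omega, by omega, by omega⟩
    rw [pow_add, ← mulVec_mulVec, ← hsymm, hpow i hi, hpow j hj]
    have := congrFun (congrFun hBB ⟨i, hi⟩) ⟨j, hj⟩
    simpa [hankel, mul_apply, dotProduct, Matrix.col] using this
  -- The moment of degree 2n + 1 is not an entry of `hankel v n`; it is the last entry of `H'`.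
  · obtain rfl : k = n + (1 + n) := by omega
    rw [pow_add, pow_add, pow_one, ← mulVec_mulVec, ← mulVec_mulVec, ← hsymm,
      hpow n (by omega)]
    have := congrFun (congrFun hBAB ⟨n, by omega⟩) ⟨n, by omega⟩
    rw [show n + (1 + n) = n + n + 1 by ring]
    simpa [hH', hankel, mul_apply, dotProduct, mulVec, Matrix.col] using this.symm

theorem posSemidef_hankel_sum {ι : Type*} [Fintype ι] {w : ι → ℝ} (hw : ∀ i, 0 ≤ w i)
    (y : ι → ℝ) (n : ℕ) : (hankel (fun k => ∑ i, w i * y i ^ k) n).PosSemidef := by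
  refine .of_dotProduct_mulVec_nonneg (isHermitian_hankel _ n) fun x => ?_
  rw [star_dotProduct_hankel_mulVec]
  have : ∑ i, ∑ j, x i * x j * ∑ l, w l * y l ^ ((i : ℕ) + (j : ℕ)) =
      ∑ l, w l * (∑ i, x i * y l ^ (i : ℕ)) ^ 2 := by
    simp only [Finset.mul_sum, sq, Finset.sum_mul]
    rw [Finset.sum_congr rfl fun i _ => Finset.sum_comm, Finset.sum_comm]
    refine Finset.sum_congr rfl fun l _ => ?_
    rw [Finset.sum_comm]
    exact Finset.sum_congr rfl fun i _ => Finset.sum_congr rfl fun j _ => by ring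
  rw [this]
  exact Finset.sum_nonneg fun l _ => mul_nonneg (hw l) (sq_nonneg _)

/-- These are the moments of Lebesgue measure on [0,1], and the square of a nonzero polynomial has
positive integral there. -/
theorem isPositiveDefinite_inv_add_one : IsPositiveDefinite fun k => ((k : ℝ) + 1)⁻¹ := by
  intro n
  refine .of_dotProduct_mulVec_pos (isHermitian_hankel _ n) fun x hx => ?_
  rw [star_dotProduct_hankel_mulVec]
  set p : Polynomial ℝ := ∑ i : Fin (n + 1), Polynomial.monomial (i : ℕ) (x i) with hp
  have hcoeff : ∀ i : Fin (n + 1), p.coeff i = x i := by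
    intro i
    simp [hp, Polynomial.coeff_monomial, Fin.val_inj]
  have hp0 : p ≠ 0 := by
    rintro h
    exact hx (funext fun i => by rw [← hcoeff i, h]; simp)
  have hint : ∑ i, ∑ j, x i * x j * (((((i : ℕ) + (j : ℕ) : ℕ) : ℝ) + 1)⁻¹) =
      ∫ t in (0 : ℝ)..1, p.eval t ^ 2 := by
    have : ∀ t : ℝ, p.eval t ^ 2 = ∑ i, ∑ j, x i * x j * t ^ ((i : ℕ) + (j : ℕ)) := by
      intro t
      simp only [hp, Polynomial.eval_finsetSum, Polynomial.eval_monomial, sq, Finset.sum_mul,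
        Finset.mul_sum, pow_add]
      rw [Finset.sum_comm]
      exact Finset.sum_congr rfl fun i _ => Finset.sum_congr rfl fun j _ => by ring
    simp only [this]
    rw [intervalIntegral.integral_finsetSum
      fun i _ => Continuous.intervalIntegrable (by fun_prop) _ _]
    refine Finset.sum_congr rfl fun i _ => ?_
    rw [intervalIntegral.integral_finsetSum
      fun i _ => Continuous.intervalIntegrable (by fun_prop) _ _]
    refine Finset.sum_congr rfl fun j _ => ?_
    rw [intervalIntegral.integral_const_mul, integral_pow]
    simp
  rw [hint]
  obtain ⟨c, hc, hc0⟩ : ∃ c ∈ Set.Icc (0 : ℝ) 1, p.eval c ≠ 0 := by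
    by_contra! h
    exact hp0 (Polynomial.eq_zero_of_infinite_isRoot p
      ((Set.Icc_infinite zero_lt_one).mono fun c hc => h c hc))
  exact intervalIntegral.integral_pos zero_lt_one (by fun_prop) (fun _ _ => sq_nonneg _)
    ⟨c, hc, by positivity⟩

/-- The Hankel-type submatrices of a partial positive definite sequence, in terms of an extension
of its terms by arbitrary values. -/
theorem IsPartialPositiveDefinite.posDef_of_injective {P : Set ℕ} {s : PartialSeq P}
    (hs : IsPartialPositiveDefinite s) {S : ℕ → ℝ} (hS : ∀ k : P, S k = s k) {ι : Type*}
    [Fintype ι] {f : ι → ℕ} (hf : Function.Injective f) (hP : ∀ i j, f i + f j ∈ P) :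
    (Matrix.of fun i j => S (f i + f j)).PosDef := by
  classical
  obtain ⟨n, hn⟩ : ∃ n, ∀ i, f i < n + 1 :=
    ⟨∑ i, f i, fun i => Nat.lt_succ_of_le
      (Finset.single_le_sum (fun _ _ => Nat.zero_le _) (Finset.mem_univ i))⟩
  set α : Finset (Fin (n + 1)) := Finset.univ.image fun i => ⟨f i, hn i⟩
  have hα : FullySpecified P α := by
    intro a ha b hb
    obtain ⟨i, -, rfl⟩ := Finset.mem_image.1 ha
    obtain ⟨j, -, rfl⟩ := Finset.mem_image.1 hb
    exact hP i j
  have hmem : ∀ i, (⟨f i, hn i⟩ : Fin (n + 1)) ∈ α :=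
    fun i => Finset.mem_image_of_mem _ (Finset.mem_univ i)
  have := (hs n α hα).submatrix (e := fun i : ι => (⟨⟨f i, hn i⟩, hmem i⟩ : α))
    fun i j h => hf (by simpa using h)
  convert this using 1
  ext i j
  exact hS ⟨f i + f j, hP i j⟩

theorem exists_completion_of_eq_sum {P : Set ℕ} {s : PartialSeq P} {ι : Type*} [Fintype ι]
    {w : ι → ℝ} (hw : ∀ i, 0 ≤ w i) (y : ι → ℝ) {ε : ℝ} (hε : 0 < ε)
    (h : ∀ k : P, s k = ∑ i, w i * y i ^ (k : ℕ) + ε * ((k : ℝ) + 1)⁻¹) :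
    ∃ t : ℕ → ℝ, IsCompletion s t ∧ IsPositiveDefinite t := by
  refine ⟨fun k => ∑ i, w i * y i ^ k + ε * ((k : ℝ) + 1)⁻¹, fun k => (h k).symm, fun n => ?_⟩
  exact ((isPositiveDefinite_inv_add_one n).smul hε).posSemidef_add (posSemidef_hankel_sum hw y n)

/-! ### Positive definite completion, by parity of the step -/

/-- For odd d every real node has a real d-th root, so a quadrature for the terms of index dk pulls
back along z ↦ z^d. -/
theorem positiveDefiniteCompletable_of_odd (m : ℕ) {d : ℕ} (hd : Odd d) :
    PositiveDefiniteCompletable (affinePattern d 0 (Set.Iic m)) := by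
  classical
  intro s hs
  set S : ℕ → ℝ := fun k => if h : k ∈ affinePattern d 0 (Set.Iic m) then s ⟨k, h⟩ else 0
  have hS : ∀ k : affinePattern d 0 (Set.Iic m), S k = s k := fun k => dif_pos k.2
  have hA : (hankel (fun k => S (d * k)) (m / 2)).PosDef := by
    have := hs.posDef_of_injective hS (f := fun i : Fin (m / 2 + 1) => d * (i : ℕ))
      (fun i j h => Fin.ext (Nat.eq_of_mul_eq_mul_left hd.pos h))
      (fun i j => ⟨i + j, by simp only [Set.mem_Iic]; omega, by ring⟩)
    simpa only [hankel, mul_add] using this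
  obtain ⟨ε, hε, hpos⟩ := hA.exists_pos_posDef_sub_smul
    (isHermitian_hankel (fun k => (((d * k : ℕ) : ℝ) + 1)⁻¹) (m / 2))
  obtain ⟨w, y, hw, hy⟩ := exists_quadrature
    (v := fun k => S (d * k) - ε * (((d * k : ℕ) : ℝ) + 1)⁻¹) hpos
  have hroot : ∀ i, ∃ z : ℝ, z ^ d = y i := fun i => by
    rcases le_total 0 (y i) with h | h
    · exact ⟨_, Real.rpow_inv_natCast_pow h hd.pos.ne'⟩
    · exact ⟨-(-y i) ^ ((d : ℝ)⁻¹), by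
        rw [hd.neg_pow, Real.rpow_inv_natCast_pow (neg_nonneg.2 h) hd.pos.ne', neg_neg]⟩
  choose z hz using hroot
  refine exists_completion_of_eq_sum hw z hε ?_
  rintro ⟨_, k, hk, rfl⟩
  have hk' : k ≤ m := hk
  rw [← hS]
  simp only [add_zero, pow_mul, hz]
  -- For odd m this needs the extra degree of Gaussian quadrature: m = 2(m/2) + 1.
  rw [← hy k (by omega)]
  ring

/-- Negative nodes have no real root of order 2e, so the rescaling is by e only. The terms of index
e·k with k odd are missing and are set to 0. -/
theorem positiveDefiniteCompletable_of_even (m : ℕ) {e : ℕ} (he : 0 < e) :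
    PositiveDefiniteCompletable (affinePattern (2 * e) 0 (Set.Iic m)) := by
  classical
  intro s hs
  set S : ℕ → ℝ := fun k =>
    if h : k ∈ affinePattern (2 * e) 0 (Set.Iic m) then s ⟨k, h⟩ else 0
  have hS : ∀ k : affinePattern (2 * e) 0 (Set.Iic m), S k = s k := fun k => dif_pos k.2
  have hodd : ∀ k, ¬ Even k → S (e * k) = 0 := by
    intro k hk
    refine dif_neg ?_
    rintro ⟨l, -, hl⟩
    refine hk ⟨l, Nat.eq_of_mul_eq_mul_left he ?_⟩
    rw [← hl]
    ring
  have hmem : ∀ i j : ℕ, i ≤ m → j ≤ m → Even (i + j) →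
      e * i + e * j ∈ affinePattern (2 * e) 0 (Set.Iic m) := by
    rintro i j hi hj ⟨l, hl⟩
    refine ⟨l, ?_, ?_⟩
    · simp only [Set.mem_Iic]
      omega
    · simp only [add_zero]
      rw [← mul_add, hl]
      ring
  -- The zeros at odd k decouple even from odd indices, and each of the two parity blocks is fully
  -- specified.
  have hA : (hankel (fun k => S (e * k)) m).PosDef := by
    refine .of_submatrix_subtype (fun i : Fin (m + 1) => Even (i : ℕ)) (isHermitian_hankel _ m)
      ?_ ?_ ?_
    · intro i j hi hj
      exact hodd _ (by rw [Nat.even_add]; tauto)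
    · have := hs.posDef_of_injective hS
        (f := fun i : {i : Fin (m + 1) // Even (i : ℕ)} => e * (i : ℕ))
        (fun i j h => Subtype.ext (Fin.ext (Nat.eq_of_mul_eq_mul_left he h)))
        (fun i j => hmem _ _ (by omega) (by omega) (i.2.add j.2))
      simp only [← mul_add] at this
      exact this
    · have := hs.posDef_of_injective hS
        (f := fun i : {i : Fin (m + 1) // ¬ Even (i : ℕ)} => e * (i : ℕ))
        (fun i j h => Subtype.ext (Fin.ext (Nat.eq_of_mul_eq_mul_left he h)))
        (fun i j => hmem _ _ (by omega) (by omega)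
          ((Nat.not_even_iff_odd.1 i.2).add_odd (Nat.not_even_iff_odd.1 j.2)))
      simp only [← mul_add] at this
      exact this
  obtain ⟨ε, hε, hpos⟩ := hA.exists_pos_posDef_sub_smul
    (isHermitian_hankel (fun k => (((e * k : ℕ) : ℝ) + 1)⁻¹) m)
  obtain ⟨w, y, hw, hy⟩ := exists_quadrature
    (v := fun k => S (e * k) - ε * (((e * k : ℕ) : ℝ) + 1)⁻¹) hpos
  have hroot : ∀ i, ∃ z : ℝ, z ^ e = |y i| := fun i =>
    ⟨|y i| ^ ((e : ℝ)⁻¹), Real.rpow_inv_natCast_pow (abs_nonneg _) he.ne'⟩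
  choose z hz using hroot
  refine exists_completion_of_eq_sum hw z hε ?_
  rintro ⟨_, k, hk, rfl⟩
  have hk' : k ≤ m := hk
  have hek : 2 * e * k + 0 = e * (2 * k) := by ring
  rw [← hS]
  -- Only even powers of the nodes occur, so replacing `y i` by its absolute value is harmless.
  simp only [hek, pow_mul, hz, sq_abs]
  simp only [← pow_mul]
  rw [← hy (2 * k) (by omega)]
  ring

/-! ### Failure of positive semidefinite completion -/

theorem IsPositive.posSemidef_hankel {t : ℕ → ℝ} (ht : IsPositive t) (n : ℕ) :
    (hankel t n).PosSemidef :=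
  .of_dotProduct_mulVec_nonneg (isHermitian_hankel t n) fun x => by
    rw [star_dotProduct_hankel_mulVec]; exact ht n x

/-- The principal minor on the indices a and j is then -t(a+j)², and it must be nonnegative. -/
theorem IsPositive.eq_zero_of_diag_eq_zero {t : ℕ → ℝ} (ht : IsPositive t) {a : ℕ}
    (ha : t (a + a) = 0) {j : ℕ} (hj : a < j) : t (a + j) = 0 := by
  have h := (ht.posSemidef_hankel j).submatrix
    (![⟨a, by omega⟩, ⟨j, by omega⟩] : Fin 2 → Fin (j + 1))
  have hdet := h.det_nonneg
  simp only [det_fin_two, submatrix_apply, hankel, of_apply, cons_val_zero, cons_val_one, ha,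
    zero_mul, zero_sub, add_comm j a] at hdet
  nlinarith [sq_nonneg (t (a + j))]

theorem not_positiveSemidefiniteCompletable (m d l : ℕ) (hm : 1 ≤ m) (hd : 1 ≤ d) (hl : Even l) :
    ¬ PositiveSemidefiniteCompletable (affinePattern d l (Set.Iic m)) := by
  classical
  intro h
  obtain ⟨a, rfl⟩ := hl
  have hmd : 0 < d * m := Nat.mul_pos hd hm
  obtain ⟨t, hts, ht⟩ := h (fun k => if (k : ℕ) = d * m + (a + a) then 1 else 0) (by
    intro n α hα
    -- Diagonal entries are specified, so 2i and 2j are at most the top index. Hence i + j can equal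
    -- it only when i = j.
    have hle : ∀ i ∈ α, (i : ℕ) + i ≤ d * m + (a + a) := by
      intro i hi
      obtain ⟨k, hk, hki⟩ := hα i hi i hi
      rw [← hki]
      exact Nat.add_le_add_right (Nat.mul_le_mul_left d hk) _
    convert PosSemidef.diagonal (n := α) (R := ℝ)
      (d := fun i => if (i : ℕ) + (i : ℕ) = d * m + (a + a) then 1 else 0) ?_ using 1
    · ext i j
      simp only [principalSubmatrix, of_apply, diagonal_apply]
      have hi := hle i i.2
      have hj := hle j j.2
      by_cases hij : i = j
      · simp [hij]
      · rw [if_neg hij, if_neg]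
        intro hsum
        exact hij (Subtype.ext (Fin.ext (by omega)))
    · intro i
      dsimp only
      split_ifs <;> simp)
  have h0 : t (a + a) = 0 := by
    exact (hts ⟨a + a, 0, by simp, by simp⟩).trans (if_neg (by simp only; omega))
  have h1 : t (a + (a + d * m)) = 1 := by
    exact (hts ⟨a + (a + d * m), m, by simp, by ring⟩).trans (if_pos (by simp only; ring))
  rw [ht.eq_zero_of_diag_eq_zero h0 (by omega)] at h1
  exact zero_ne_one h1

end HankelCompletion

theorem mainTheorem7 (m d l₀ : ℕ) (hd : 1 ≤ d) (hl₀ : Even l₀) :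
    (1 ≤ m →
      ¬ HankelCompletion.PositiveSemidefiniteCompletable
          (HankelCompletion.affinePattern d l₀ (Set.Iic m))) ∧
      HankelCompletion.PositiveDefiniteCompletable
        (HankelCompletion.affinePattern d 0 (Set.Iic m)) := by
  refine ⟨fun hm => HankelCompletion.not_positiveSemidefiniteCompletable m d l₀ hm hd hl₀, ?_⟩
  rcases Nat.even_or_odd' d with ⟨e, rfl | rfl⟩
  · exact HankelCompletion.positiveDefiniteCompletable_of_even m (by omega)
  · exact HankelCompletion.positiveDefiniteCompletable_of_odd m ⟨e, rfl⟩
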